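/- Let $G=(V,E)$ be a finite simple graph, let $B\subseteq V$ and $\gamma\in\{-1,1\}^B$ (with $B=\emptyset$ for the free boundary condition), and let $J=(J_e)_{e\in E}$ be i.i.d. standard Gaussian random variables. The Edwards--Anderson Hamiltonian is $H_J(\sigma)=-\sum_{\{i,j\}\in E}J_{ij}\sigma_i\sigma_j$, $\sigma\in\{-1,1\}^V$. For an edge $e=\{i,j\}$, let $\sigma^1$ (resp. $\sigma^2$) be a minimizer of $H_J$ among the configurations with $\sigma_k=\gamma_k$ for all $k\in B$ and $\sigma_i=\sigma_j$ (resp. $\sigma_i=-\sigma_j$). The critical droplet $D(e)$ is the set of sites at which $\sigma^1$ and $\sigma^2$ disagree; it is almost surely unique in the cases below, except that for $B=\emptyset$ it is determined only up to complementation, and then $|D(e)|$ denotes the minimum of the sizes of the set and of its complement. If both endpoints of $e$ lie in $B$ (so that one of the two constraints cannot be met), put $D(e)=\emptyset$. For every $d\ge 1$ there is a constant $C(d)>0$, depending only on $d$, such that $$\frac{1}{|E|}\sum_{e\in E}\mathbb{E}|D(e)|\ \ge\ C(d)\,L$$ in each of the following cases: (i) $G$ is the cube $\{0,1,\ldots,L\}^d$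 with nearest-neighbor edges, $L\ge 2$, $B$ is the set of vertices with at least one coordinate equal to $0$ or $L$, and $\gamma\in\{-1,1\}^B$ is an arbitrary fixed (disorder-independent) boundary condition; (ii) $G$ is the cube $\{0,1,\ldots,L\}^d$ with nearest-neighbor edges, $L\ge 1$, with the free boundary condition $B=\emptyset$; (iii) (periodic boundary) $G$ is the simple graph obtained from the cube $\{0,1,\ldots,L\}^d$ by identifying opposite faces, i.e. the discrete torus $(\mathbb{Z}/L\mathbb{Z})^d$, $L\ge 2$, with $B=\emptyset$. -/

import Mathlib

namespace EdwardsAnderson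

open MeasureTheory ProbabilityTheory

/-- A spin configuration in `{-1, 1}^V`. -/
abbrev Config (V : Type*) := V → ℤˣ

/-- The product `σ i * σ j` of the two spins at the ends of the edge `{i, j}`. -/
def spinProduct {V : Type*} (σ : Config V) (e : Sym2 V) : ℤˣ := (e.map σ).mul

theorem spinProduct_mk {V : Type*} (σ : Config V) (i j : V) :
    spinProduct σ s(i, j) = σ i * σ j := rfl

theorem spinProduct_eq_one_iff {V : Type*} (σ : Config V) (i j : V) :
    spinProduct σ s(i, j) = 1 ↔ σ i = σ j := by
  rw [spinProduct_mk]
  rcases Int.units_eq_one_or (σ i) with h | h <;> rcases Int.units_eq_one_or (σ j) with h' | h' <;>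
    rw [h, h'] <;> decide

theorem spinProduct_eq_neg_one_iff {V : Type*} (σ : Config V) (i j : V) :
    spinProduct σ s(i, j) = -1 ↔ σ i = -σ j := by
  rw [spinProduct_mk]
  rcases Int.units_eq_one_or (σ i) with h | h <;> rcases Int.units_eq_one_or (σ j) with h' | h' <;>
    rw [h, h'] <;> decide

section Model

variable {V : Type*} (G : SimpleGraph V) [Fintype G.edgeSet]

/-- The law of the disorder: independent standard Gaussian couplings, one for each edge. -/
noncomputable def disorderLaw : Measure (G.edgeSet → ℝ) :=
  Measure.pi fun _ => gaussianReal 0 1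

/-- The Edwards-Anderson Hamiltonian `H_J(σ) = - ∑_{{i,j} ∈ E} J_{ij} σ_i σ_j`. -/
noncomputable def hamiltonian (J : G.edgeSet → ℝ) (σ : Config V) : ℝ :=
  -∑ e : G.edgeSet, J e * ((spinProduct σ (e : Sym2 V) : ℤ) : ℝ)

/-- `σ` minimizes the Hamiltonian among all configurations that agree with `γ` on the boundary `B`
and whose spins at the two ends of `e` have product `s`. -/
def IsConstrainedGroundState (B : Finset V) (γ : B → ℤˣ) (J : G.edgeSet → ℝ)
    (e : Sym2 V) (s : ℤˣ) (σ : Config V) : Prop :=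
  (∀ v : B, σ v = γ v) ∧ spinProduct σ e = s ∧
    ∀ τ : Config V, (∀ v : B, τ v = γ v) → spinProduct τ e = s →
      hamiltonian G J σ ≤ hamiltonian G J τ

/-- `A` is a critical droplet of the edge `e = {i, j}`: the set of sites at which an energy
minimizer `σ₁` under the constraint `σ i = σ j` and an energy minimizer `σ₂` under the
constraint `σ i = -σ j` disagree. -/
def IsCriticalDroplet (B : Finset V) (γ : B → ℤˣ) (J : G.edgeSet → ℝ)
    (e : Sym2 V) (A : Finset V) : Prop :=
  ∃ σ₁ σ₂ : Config V, IsConstrainedGroundState G B γ J e 1 σ₁ ∧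
    IsConstrainedGroundState G B γ J e (-1) σ₂ ∧ ∀ v, v ∈ A ↔ σ₁ v ≠ σ₂ v

variable [Fintype V] [DecidableEq V]

/-- The size assigned to a droplet `A`: it is `|A|` if there is a boundary condition, and the
minimum of `|A|` and `|V \ A|` under the free boundary condition (`B = ∅`). -/
def dropletCard (B A : Finset V) : ℕ :=
  if B = ∅ then min A.card Aᶜ.card else A.card

/-- The size `|D(e)|` of the critical droplet of the edge `e` in the environment `J`.

On the connected graphs below, for almost every `J` the critical droplet of an edge with an end
outside `B` is unique (up to exchanging `A` and `V \ A` if `B = ∅`), so that the infimum is over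
a single number; on the null set of environments with ties the least value is taken.
If both ends of `e` lie in `B`, one of the two constraints cannot be met, the ground state does not
depend on `J e`, there is no droplet, and the size is `0` (the infimum of the empty set in `ℕ`). -/
noncomputable def criticalDropletSize (B : Finset V) (γ : B → ℤˣ) (J : G.edgeSet → ℝ)
    (e : Sym2 V) : ℕ :=
  sInf {n : ℕ | ∃ A : Finset V, IsCriticalDroplet G B γ J e A ∧ n = dropletCard B A}

/-- The average `(1 / |E|) * ∑_{e ∈ E} 𝔼 |D(e)|` of the expected critical droplet sizes. -/
noncomputable def averageDropletSize (B : Finset V) (γ : B → ℤˣ) : ℝ :=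
  (1 / (Fintype.card G.edgeSet : ℝ)) *
    ∑ e : G.edgeSet, ∫ J, (criticalDropletSize G B γ J (e : Sym2 V) : ℝ) ∂(disorderLaw G)

/-- The average of the expected critical droplet sizes under the free boundary condition. -/
noncomputable def averageDropletSizeFree : ℝ :=
  averageDropletSize G ∅ (fun v => absurd v.2 (Finset.notMem_empty _))

end Model

section Lattice

/-- The cube `{0, 1, …, L}^d` with nearest-neighbour edges: `x` and `y` are adjacent if and only if
their `ℓ¹` distance is `1`. -/
def cubeGraph (d L : ℕ) : SimpleGraph (Fin d → Fin (L + 1)) where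
  Adj x y := ∑ k, |((x k : ℕ) : ℤ) - ((y k : ℕ) : ℤ)| = 1
  symm := ⟨fun x y h => by simpa only [abs_sub_comm] using h⟩
  loopless := ⟨fun x h => by simp at h⟩

instance (d L : ℕ) : DecidableRel (cubeGraph d L).Adj :=
  fun x y => inferInstanceAs
    (Decidable (∑ k, |((x k : ℕ) : ℤ) - ((y k : ℕ) : ℤ)| = 1))

/-- The usual boundary of the cube: the vertices with at least one coordinate equal to `0` or
`L`. -/
def cubeBoundary (d L : ℕ) : Finset (Fin d → Fin (L + 1)) :=
  Finset.univ.filter fun x => ∃ k, (x k : ℕ) = 0 ∨ (x k : ℕ) = L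

/-- The cube `{0, 1, …, L}^d` with opposite faces identified, i.e. the discrete torus
`(ℤ / L)^d`: two distinct vertices are adjacent if and only if they differ by a unit step in one
coordinate direction. -/
def torusGraph (d L : ℕ) : SimpleGraph (Fin d → ZMod L) where
  Adj x y := x ≠ y ∧ ∃ k, y = x + Pi.single k 1 ∨ x = y + Pi.single k 1
  symm := ⟨fun _ _ h => ⟨h.1.symm, h.2.imp fun _ hk => hk.symm⟩⟩
  loopless := ⟨fun _ h => h.1 rfl⟩

instance (d L : ℕ) : DecidableRel (torusGraph d L).Adj :=
  fun x y => inferInstanceAs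
    (Decidable (x ≠ y ∧ ∃ k, y = x + Pi.single k 1 ∨ x = y + Pi.single k 1))

end Lattice

end EdwardsAnderson

namespace EdwardsAnderson

open MeasureTheory ProbabilityTheory

/-! Let `S` be a set of sites disjoint from `B`, with `u ∉ S` and `v ∈ S`. Reversing the couplings
across the boundary of `S` preserves their law and almost surely reverses the ground state in `S`
relative to its complement, so the relative sign of the ground state at `u` and `v` changes.
Reversing these couplings one at a time, each intermediate environment having the same law, shows
that the probabilities that one reversal changes this sign sum to at least 1 over the cut. Reversing
`J e` alone can only replace one constrained minimizer by the other, so such a change means that the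
droplet of `e` separates `u` from `v` (`one_le_sum_edgeCut_measure_dropletSeparates`).

If `h` is 1-Lipschitz along edges and zero on `B` and at `u`, its level sets have disjoint cuts;
hence the expected number of edges whose droplet separates `u` and `v` is at least `h v`
(`natCast_le_sum_measure_dropletSeparates`). With `u ∈ B`, summing over `v` bounds the total droplet
size below by the total depth, of order `L ^ (d + 1)`. With `B = ∅`, summing over pairs counts each
droplet at most `2 |V|` times its size. Dividing by the number of edges, at most `d |V|`, leaves a
multiple of `L`. -/

/-- A nontrivial linear relation between independent Gaussian variables has probability zero. -/
theorem measure_pi_gaussianReal_linear_relation {ι : Type*} [Fintype ι] (c : ι → ℝ) (i : ι)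
    (hi : c i ≠ 0) :
    (Measure.pi fun _ : ι => gaussianReal 0 1) {J | ∑ k, J k * c k = 0} = 0 := by
  classical
  have : NullSingletonClass (gaussianReal 0 1) := nullSingletonClass_gaussianReal one_ne_zero
  -- Given all couplings other than `J i`, the relation pins `J i` to a single value.
  have hφ := measurePreserving_piEquivPiSubtypeProd (fun _ : ι => gaussianReal 0 1) (fun k => k ≠ i)
  let N : Set (({k // k ≠ i} → ℝ) × ({k // ¬ k ≠ i} → ℝ)) :=
    {p | ∑ k, p.1 k * c k + ∑ k, p.2 k * c k = 0}
  have hN : MeasurableSet N := measurableSet_eq_fun (by fun_prop) measurable_const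
  have hpre : {J : ι → ℝ | ∑ k, J k * c k = 0} =
      (MeasurableEquiv.piEquivPiSubtypeProd (fun _ => ℝ) (fun k => k ≠ i)) ⁻¹' N := by
    ext J
    have := Fintype.sum_subtype_add_sum_subtype (fun k => k ≠ i) (fun k => J k * c k)
    simp only [Set.mem_ofPred_eq, ← this]
    rfl
  rw [hpre, hφ.measure_preimage hN.nullMeasurableSet, Measure.measure_prod_null hN]
  refine Filter.Eventually.of_forall fun y => ?_
  let j : {k // ¬ k ≠ i} := ⟨i, not_not.mpr rfl⟩
  have hj : ∀ k : {k // ¬ k ≠ i}, k = j := fun k => Subtype.ext (not_not.mp k.2)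
  refine measure_mono_null ?_ (Measure.pi_hyperplane (fun _ => gaussianReal 0 1) j
    (-(∑ k, y k * c k) / c i))
  intro z hz
  have hz' : ∑ k, y k * c k + ∑ k, z k * c k = 0 := hz
  rw [Fintype.sum_eq_single j (fun k hk => absurd (hj k) hk)] at hz'
  change z j = _
  rw [eq_div_iff hi]
  linarith

/-! ### Reversal of couplings and invariance of the law -/

section Flip

variable {ι : Type*} [DecidableEq ι]

/-- Reversal of the signs of the couplings in `T`. -/
def flip (T : Finset ι) (J : ι → ℝ) : ι → ℝ := fun e => if e ∈ T then -J e else J e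

theorem measurable_flip (T : Finset ι) : Measurable (flip T) := by
  refine measurable_pi_lambda _ fun e => ?_
  unfold flip
  split_ifs <;> fun_prop

theorem map_flip [Fintype ι] (T : Finset ι) :
    (Measure.pi fun _ : ι => gaussianReal 0 1).map (flip T) =
      Measure.pi fun _ : ι => gaussianReal 0 1 := by
  refine (measurePreserving_pi (fun _ : ι => gaussianReal 0 1) (fun _ : ι => gaussianReal 0 1)
    (f := fun e x => if e ∈ T then -x else x) fun e => ?_).map_eq
  by_cases h : e ∈ T
  · simp only [h, if_true]
    exact ⟨by fun_prop, by rw [gaussianReal_map_neg, neg_zero]⟩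
  · simp only [h, if_false]
    exact MeasurePreserving.id _

theorem flip_insert {e : ι} {T : Finset ι} (he : e ∉ T) (J : ι → ℝ) :
    flip (insert e T) J = flip T (flip {e} J) := by
  funext k
  by_cases hk : k = e
  · subst hk; simp [flip, he]
  · simp [flip, hk]

/-- If a function of the couplings is altered by the reversal of the couplings in `T`, then it is
altered by one of the reversals of a single coupling in `T`, up to a change of the environment that
preserves its law. -/
theorem measure_ne_flip_le [Fintype ι] {α : Type*} (R : (ι → ℝ) → α) (T : Finset ι) :
    (Measure.pi fun _ : ι => gaussianReal 0 1) {J | R J ≠ R (flip T J)} ≤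
      ∑ e ∈ T, (Measure.pi fun _ : ι => gaussianReal 0 1) {J | R J ≠ R (flip {e} J)} := by
  induction T using Finset.induction_on with
  | empty =>
    have h (J : ι → ℝ) : flip ∅ J = J := by funext e; simp [flip]
    simp [h]
  | insert e T he ih =>
    rw [Finset.sum_insert he]
    refine le_trans (measure_mono (t := {J | R J ≠ R (flip {e} J)} ∪
      flip {e} ⁻¹' {J | R J ≠ R (flip T J)}) ?_) ((measure_union_le _ _).trans
        (add_le_add le_rfl (le_trans ?_ ih)))
    · intro J hJ
      by_contra hcon
      simp only [Set.mem_union, Set.mem_ofPred_eq, Set.mem_preimage, not_or, not_not] at hcon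
      exact hJ (by rw [flip_insert he, hcon.1, hcon.2])
    -- This inequality holds for every set, so `R` need not be measurable.
    · refine (Measure.le_map_apply (measurable_flip _).aemeasurable _).trans ?_
      rw [map_flip]

end Flip

/-! ### Ground states, gauge symmetry and separation by droplets -/

section GroundState

theorem eq_of_preconnected {V : Type*} {G : SimpleGraph V} {α : Type*} (hG : G.Preconnected) {f : V → α}
    (hf : ∀ x y, G.Adj x y → f x = f y) (x y : V) : f x = f y := by
  obtain ⟨p⟩ := hG x y
  induction p with
  | nil => rfl
  | cons h _ ih => exact (hf _ _ h).trans ih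

variable {V : Type*} (G : SimpleGraph V) [Fintype G.edgeSet]

/-- `σ` minimizes the Hamiltonian among the configurations that agree with `γ` on `B`. -/
def IsGroundState (B : Finset V) (γ : B → ℤˣ) (J : G.edgeSet → ℝ) (σ : Config V) : Prop :=
  (∀ v : B, σ v = γ v) ∧
    ∀ τ : Config V, (∀ v : B, τ v = γ v) → hamiltonian G J σ ≤ hamiltonian G J τ

theorem exists_isGroundState [Fintype V] [DecidableEq V] (B : Finset V) (γ : B → ℤˣ)
    (J : G.edgeSet → ℝ) : ∃ σ, IsGroundState G B γ J σ := by
  obtain ⟨σ, hσ, hmin⟩ := Set.exists_min_image {σ : Config V | ∀ v : B, σ v = γ v}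
    (hamiltonian G J) (Set.toFinite _)
    ⟨fun v => if h : v ∈ B then γ ⟨v, h⟩ else 1, fun v => by simp⟩
  exact ⟨σ, hσ, hmin⟩

/-- Configurations of the same energy have the same product along each edge. -/
def NoTies (J : G.edgeSet → ℝ) : Prop :=
  ∀ σ τ : Config V, hamiltonian G J σ = hamiltonian G J τ →
    ∀ e : G.edgeSet, spinProduct σ (e : Sym2 V) = spinProduct τ (e : Sym2 V)

/-- A tie between two configurations whose products differ on some edge is a nontrivial linear
relation among the couplings, and there are finitely many pairs. -/
theorem ae_noTies [Finite V] : ∀ᵐ J ∂disorderLaw G, NoTies G J := by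
  unfold NoTies
  rw [ae_all_iff]; intro σ
  rw [ae_all_iff]; intro τ
  by_cases h : ∃ e : G.edgeSet, spinProduct σ (e : Sym2 V) ≠ spinProduct τ (e : Sym2 V)
  · obtain ⟨e, he⟩ := h
    let c : G.edgeSet → ℝ := fun e =>
      ((spinProduct σ (e : Sym2 V) : ℤ) : ℝ) - ((spinProduct τ (e : Sym2 V) : ℤ) : ℝ)
    have hc : c e ≠ 0 := by
      refine sub_ne_zero.mpr fun h => he ?_
      exact Units.ext (by exact_mod_cast h)
    refine measure_mono_null ?_ (measure_pi_gaussianReal_linear_relation c e hc)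
    intro J hJ
    by_contra hne
    refine hJ fun heq => absurd ?_ hne
    have : ∑ k, J k * c k = hamiltonian G J τ - hamiltonian G J σ := by
      simp only [c, hamiltonian, mul_sub, Finset.sum_sub_distrib]
      ring
    simp only [Set.mem_ofPred_eq, this, heq, sub_self]
  · push Not at h
    exact Filter.Eventually.of_forall fun J _ => h

variable {G}

/-- On a connected graph the edge products determine a configuration up to a global sign. -/
theorem NoTies.mul_eq_mul (hG : G.Preconnected) {J : G.edgeSet → ℝ} (hJ : NoTies G J)
    {σ τ : Config V} (h : hamiltonian G J σ = hamiltonian G J τ) (x y : V) :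
    σ x * τ x = σ y * τ y := by
  refine eq_of_preconnected hG (f := fun x => σ x * τ x) (fun x y hxy => ?_) x y
  have key : ∀ a b c d : ℤˣ, a * b = c * d → a * c = b * d := by decide
  exact key _ _ _ _ (hJ σ τ h ⟨s(x, y), hxy⟩)

theorem hamiltonian_flip_singleton [DecidableEq G.edgeSet] (J : G.edgeSet → ℝ) (e : G.edgeSet)
    (σ : Config V) : hamiltonian G (flip {e} J) σ =
      hamiltonian G J σ + 2 * J e * ((spinProduct σ (e : Sym2 V) : ℤ) : ℝ) := by
  have h : ∀ k : G.edgeSet, flip {e} J k * ((spinProduct σ (k : Sym2 V) : ℤ) : ℝ) =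
      J k * ((spinProduct σ (k : Sym2 V) : ℤ) : ℝ) -
        if k = e then 2 * J e * ((spinProduct σ (e : Sym2 V) : ℤ) : ℝ) else 0 := by
    intro k
    by_cases hk : k = e
    · subst hk; simp [flip]; ring
    · simp [flip, hk]
  simp only [hamiltonian, h, Finset.sum_sub_distrib, Finset.sum_ite_eq', Finset.mem_univ, if_true]
  ring

theorem IsGroundState.isConstrainedGroundState {B : Finset V} {γ : B → ℤˣ} {J : G.edgeSet → ℝ}
    {σ : Config V} (h : IsGroundState G B γ J σ) (e : Sym2 V) :
    IsConstrainedGroundState G B γ J e (spinProduct σ e) σ :=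
  ⟨h.1, rfl, fun τ hτ _ => h.2 τ hτ⟩

/-- Under the constraint the term of `e` is constant, so the reversal shifts all competing energies
equally. -/
theorem isConstrainedGroundState_flip_singleton [DecidableEq G.edgeSet] {B : Finset V}
    {γ : B → ℤˣ} {J : G.edgeSet → ℝ} {e : G.edgeSet} {s : ℤˣ} {σ : Config V} :
    IsConstrainedGroundState G B γ (flip {e} J) (e : Sym2 V) s σ ↔
      IsConstrainedGroundState G B γ J (e : Sym2 V) s σ := by
  refine and_congr_right fun _ => and_congr_right fun hσ => forall_congr' fun τ =>
    imp_congr_right fun _ => imp_congr_right fun hτ => ?_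
  rw [hamiltonian_flip_singleton, hamiltonian_flip_singleton, hσ, hτ, add_le_add_iff_right]

theorem IsConstrainedGroundState.hamiltonian_eq {B : Finset V} {γ : B → ℤˣ} {J : G.edgeSet → ℝ}
    {e : Sym2 V} {s : ℤˣ} {σ τ : Config V} (hσ : IsConstrainedGroundState G B γ J e s σ)
    (hτ : IsConstrainedGroundState G B γ J e s τ) : hamiltonian G J σ = hamiltonian G J τ :=
  le_antisymm (hσ.2.2 τ hτ.1 hτ.2.1) (hτ.2.2 σ hσ.1 hσ.2.1)

variable (G) in
/-- Some critical droplet of `e` contains exactly one of the sites `u` and `v`. -/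
def DropletSeparates (B : Finset V) (γ : B → ℤˣ) (J : G.edgeSet → ℝ) (e : Sym2 V) (u v : V) :
    Prop :=
  ∃ A : Finset V, IsCriticalDroplet G B γ J e A ∧ ¬(u ∈ A ↔ v ∈ A)

/-- If the reversal of one coupling changes the relative sign of the ground state at two sites, then
these sites are separated by the critical droplet. -/
theorem dropletSeparates_of_isGroundState_flip [Fintype V] [DecidableEq V]
    [DecidableEq G.edgeSet] (hG : G.Preconnected)
    {B : Finset V} {γ : B → ℤˣ} {J : G.edgeSet → ℝ} (hJ : NoTies G J) {e : G.edgeSet}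
    {σ τ : Config V} (hσ : IsGroundState G B γ J σ) (hτ : IsGroundState G B γ (flip {e} J) τ)
    {u v : V} (huv : σ u * σ v ≠ τ u * τ v) : DropletSeparates G B γ J (e : Sym2 V) u v := by
  have hσ' := hσ.isConstrainedGroundState (e : Sym2 V)
  have hτ' := isConstrainedGroundState_flip_singleton.mp (hτ.isConstrainedGroundState (e : Sym2 V))
  have key : ∀ a b c d : ℤˣ, a * b ≠ c * d → ¬(a ≠ c ↔ b ≠ d) := by decide
  have key' : ∀ a b c d : ℤˣ, a * c = b * d → a * b = c * d := by decide
  rcases Int.units_eq_one_or (spinProduct σ (e : Sym2 V)) with h1 | h1 <;>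
    rcases Int.units_eq_one_or (spinProduct τ (e : Sym2 V)) with h2 | h2 <;>
    rw [h1] at hσ' <;> rw [h2] at hτ'
  -- Equal products at `e` make `σ` and `τ` minimizers of the same constrained problem in `J`, hence
  -- equal up to a global sign.
  · exact absurd (key' _ _ _ _ (hJ.mul_eq_mul hG (hσ'.hamiltonian_eq hτ') u v)) huv
  · refine ⟨Finset.univ.filter fun x => σ x ≠ τ x, ⟨σ, τ, hσ', hτ', by simp⟩, ?_⟩
    simpa only [Finset.mem_filter_univ] using key _ _ _ _ huv
  · refine ⟨Finset.univ.filter fun x => τ x ≠ σ x, ⟨τ, σ, hτ', hσ', by simp⟩, ?_⟩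
    simpa only [Finset.mem_filter_univ] using key _ _ _ _ huv.symm
  · exact absurd (key' _ _ _ _ (hJ.mul_eq_mul hG (hσ'.hamiltonian_eq hτ') u v)) huv

variable (G) in
/-- The edges between `S` and its complement. -/
noncomputable def edgeCut (S : Set V) : Finset G.edgeSet := by
  classical
  exact Finset.univ.filter fun e => ∃ x y, (e : Sym2 V) = s(x, y) ∧ x ∈ S ∧ y ∉ S

theorem mem_edgeCut {S : Set V} {e : G.edgeSet} :
    e ∈ edgeCut G S ↔ ∃ x y, (e : Sym2 V) = s(x, y) ∧ x ∈ S ∧ y ∉ S := by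
  simp [edgeCut]

open Classical in
/-- The configuration obtained by reversing the spins in `S`. -/
noncomputable def flipSpins (S : Set V) (σ : Config V) : Config V :=
  fun x => if x ∈ S then -σ x else σ x

theorem flipSpins_flipSpins (S : Set V) (σ : Config V) : flipSpins S (flipSpins S σ) = σ := by
  funext x
  by_cases h : x ∈ S <;> simp [flipSpins, h]

theorem spinProduct_flipSpins [DecidableEq G.edgeSet] (S : Set V) (σ : Config V) (e : G.edgeSet) :
    ((spinProduct (flipSpins S σ) (e : Sym2 V) : ℤˣ) : ℤ) =
      if e ∈ edgeCut G S then -((spinProduct σ (e : Sym2 V) : ℤˣ) : ℤ)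
      else ((spinProduct σ (e : Sym2 V) : ℤˣ) : ℤ) := by
  obtain ⟨e, he⟩ := e
  induction e using Sym2.ind with
  | _ x y =>
    have hcut : (⟨s(x, y), he⟩ : G.edgeSet) ∈ edgeCut G S ↔ (x ∈ S ∧ y ∉ S) ∨ (y ∈ S ∧ x ∉ S) := by
      rw [mem_edgeCut]
      constructor
      · rintro ⟨a, b, hab, ha, hb⟩
        rcases Sym2.eq_iff.mp hab with ⟨rfl, rfl⟩ | ⟨rfl, rfl⟩
        · exact Or.inl ⟨ha, hb⟩
        · exact Or.inr ⟨ha, hb⟩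
      · rintro (h | h)
        · exact ⟨x, y, rfl, h⟩
        · exact ⟨y, x, Sym2.eq_swap, h⟩
    by_cases hx : x ∈ S <;> by_cases hy : y ∈ S <;>
      simp only [hx, hy, not_true_eq_false, not_false_eq_true, and_true, and_false, or_false,
        or_true, iff_true, iff_false] at hcut <;>
      simp [spinProduct_mk, flipSpins, hcut, hx, hy]

/-- Gauge symmetry: reversing the spins in `S` changes exactly the products across the cut. -/
theorem hamiltonian_flip_edgeCut [DecidableEq G.edgeSet] (S : Set V) (J : G.edgeSet → ℝ)
    (σ : Config V) : hamiltonian G (flip (edgeCut G S) J) σ = hamiltonian G J (flipSpins S σ) := by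
  unfold hamiltonian
  congr 1
  refine Finset.sum_congr rfl fun e _ => ?_
  rw [spinProduct_flipSpins]
  by_cases h : e ∈ edgeCut G S <;> simp [flip, h]

/-- Reversing the couplings across the boundary of `S` reverses the ground state in `S`. -/
theorem mul_ne_mul_of_isGroundState_flip_edgeCut [DecidableEq G.edgeSet] (hG : G.Preconnected)
    {B : Finset V} {γ : B → ℤˣ} {J : G.edgeSet → ℝ} (hJ : NoTies G J) {S : Set V}
    (hS : ∀ x ∈ B, x ∉ S) {σ τ : Config V} (hσ : IsGroundState G B γ J σ)
    (hτ : IsGroundState G B γ (flip (edgeCut G S) J) τ) {u v : V} (hu : u ∉ S) (hv : v ∈ S) :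
    σ u * σ v ≠ τ u * τ v := by
  have hbc : ∀ ρ : Config V, (∀ x : B, ρ x = γ x) → ∀ x : B, flipSpins S ρ x = γ x :=
    fun ρ hρ x => by simp [flipSpins, hS x x.2, hρ]
  -- By the gauge symmetry `flipSpins S τ` is also a ground state for `J`.
  have heq : hamiltonian G J σ = hamiltonian G J (flipSpins S τ) := by
    refine le_antisymm (hσ.2 _ (hbc τ hτ.1)) ?_
    have := hτ.2 _ (hbc σ hσ.1)
    rwa [hamiltonian_flip_edgeCut, hamiltonian_flip_edgeCut, flipSpins_flipSpins] at this
  have h := hJ.mul_eq_mul hG heq u v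
  simp only [flipSpins, hu, hv, if_true, if_false] at h
  have key : ∀ a b c d : ℤˣ, a * c = b * -d → a * b ≠ c * d := by decide
  exact key _ _ _ _ h

instance : IsProbabilityMeasure (disorderLaw G) := by
  unfold disorderLaw; infer_instance

/-- The boundary of a set that separates two sites contains, in expectation, at least one edge whose
critical droplet separates these sites. -/
theorem one_le_sum_edgeCut_measure_dropletSeparates [Fintype V] [DecidableEq V]
    (hG : G.Preconnected) {B : Finset V} (γ : B → ℤˣ) {S : Set V} (hS : ∀ x ∈ B, x ∉ S) {u v : V}
    (hu : u ∉ S) (hv : v ∈ S) :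
    1 ≤ ∑ e ∈ edgeCut G S, disorderLaw G {J | DropletSeparates G B γ J (e : Sym2 V) u v} := by
  classical
  choose gs hgs using exists_isGroundState G B γ
  let R : (G.edgeSet → ℝ) → ℤˣ := fun J => gs J u * gs J v
  have h1 : 1 ≤ disorderLaw G {J | R J ≠ R (flip (edgeCut G S) J)} := by
    rw [← measure_univ (μ := disorderLaw G)]
    refine measure_mono_ae ?_
    filter_upwards [ae_noTies G] with J hJ _
    exact mul_ne_mul_of_isGroundState_flip_edgeCut hG hJ hS (hgs _) (hgs _) hu hv
  refine h1.trans ?_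
  refine (measure_ne_flip_le R (edgeCut G S)).trans (Finset.sum_le_sum fun e _ => ?_)
  refine measure_mono_ae ?_
  filter_upwards [ae_noTies G] with J hJ hR
  exact dropletSeparates_of_isGroundState_flip hG hJ (hgs _) (hgs _) hR

/-- Each level set `{x | t ≤ h x}` with `1 ≤ t ≤ h v` avoids `B` and `u` and contains `v`, so its
cut contributes at least 1. An edge changes `h` by at most 1 and thus lies in at most one of these
cuts. -/
theorem natCast_le_sum_measure_dropletSeparates [Fintype V] [DecidableEq V]
    (hG : G.Preconnected) {B : Finset V} (γ : B → ℤˣ) {h : V → ℕ}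
    (hh : ∀ x y, G.Adj x y → h x ≤ h y + 1) (hB : ∀ x ∈ B, h x = 0) {u : V} (hu : h u = 0)
    (v : V) :
    (h v : ENNReal) ≤
      ∑ e : G.edgeSet, disorderLaw G {J | DropletSeparates G B γ J (e : Sym2 V) u v} := by
  classical
  have hcut : ∀ t ∈ Finset.Icc 1 (h v), 1 ≤ ∑ e ∈ edgeCut G {x | t ≤ h x},
      disorderLaw G {J | DropletSeparates G B γ J (e : Sym2 V) u v} := by
    intro t ht
    rw [Finset.mem_Icc] at ht
    refine one_le_sum_edgeCut_measure_dropletSeparates hG γ (fun x hx => ?_) ?_ ht.2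
    · simp [hB x hx]; omega
    · simp [hu]; omega
  have hdisj : Set.PairwiseDisjoint (Finset.Icc 1 (h v) : Set ℕ)
      fun t => edgeCut G {x | t ≤ h x} := by
    intro s _ t _ hst
    rw [Function.onFun, Finset.disjoint_left]
    rintro ⟨e, he⟩ hs ht
    obtain ⟨x, y, hxy, hx, hy⟩ := mem_edgeCut.mp hs
    obtain ⟨x', y', hxy', hx', hy'⟩ := mem_edgeCut.mp ht
    simp only [Set.mem_ofPred_eq, not_le] at hx hy hx' hy' hxy hxy'
    subst hxy
    have h1 := hh x y he
    have h2 := hh y x (G.adj_symm he)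
    rcases Sym2.eq_iff.mp hxy' with ⟨rfl, rfl⟩ | ⟨rfl, rfl⟩ <;> omega
  calc (h v : ENNReal) = ∑ t ∈ Finset.Icc 1 (h v), 1 := by simp
    _ ≤ _ := Finset.sum_le_sum hcut
    _ = _ := (Finset.sum_biUnion hdisj).symm
    _ ≤ _ := Finset.sum_le_sum_of_subset (Finset.subset_univ _)

end GroundState

/-! ### From separation probabilities to expected droplet sizes -/

section DropletSize

variable {V : Type*} {G : SimpleGraph V} [Fintype G.edgeSet]

theorem measurable_isConstrainedGroundState [Finite V] (B : Finset V) (γ : B → ℤˣ) (e : Sym2 V)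
    (s : ℤˣ) (σ : Config V) :
    Measurable fun J : G.edgeSet → ℝ => IsConstrainedGroundState G B γ J e s σ := by
  have hH (ρ : Config V) : Measurable fun J : G.edgeSet → ℝ => hamiltonian G J ρ := by
    unfold hamiltonian
    fun_prop
  exact measurable_const.and (measurable_const.and (Measurable.forall fun τ =>
    measurable_const.imp (measurable_const.imp
      (measurableSet_setOfPred.mp (measurableSet_le (hH σ) (hH τ))))))

theorem measurable_isCriticalDroplet [Finite V] (B : Finset V) (γ : B → ℤˣ) (e : Sym2 V)
    (A : Finset V) : Measurable fun J : G.edgeSet → ℝ => IsCriticalDroplet G B γ J e A :=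
  Measurable.exists fun _ => Measurable.exists fun _ =>
    (measurable_isConstrainedGroundState B γ e 1 _).and
      ((measurable_isConstrainedGroundState B γ e (-1) _).and measurable_const)

theorem measurableSet_dropletSeparates [Finite V] (B : Finset V) (γ : B → ℤˣ) (e : Sym2 V)
    (u v : V) : MeasurableSet {J : G.edgeSet → ℝ | DropletSeparates G B γ J e u v} :=
  measurableSet_setOfPred.mpr (Measurable.exists fun A =>
    (measurable_isCriticalDroplet B γ e A).and measurable_const)

variable [Fintype V] [DecidableEq V]

/-- The size depends on `J` only through which of the finitely many sets are droplets. -/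
theorem measurable_criticalDropletSize (B : Finset V) (γ : B → ℤˣ) (e : Sym2 V) :
    Measurable fun J : G.edgeSet → ℝ => criticalDropletSize G B γ J e :=
  (Measurable.of_discrete (f := fun P : Finset V → Prop =>
    sInf {n : ℕ | ∃ A : Finset V, P A ∧ n = dropletCard B A})).comp
      (measurable_pi_lambda _ fun A => measurable_isCriticalDroplet B γ e A)

theorem dropletCard_le (B A : Finset V) : dropletCard B A ≤ Fintype.card V := by
  unfold dropletCard
  split_ifs
  · exact (min_le_left _ _).trans (Finset.card_le_univ A)
  · exact Finset.card_le_univ A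

theorem criticalDropletSize_le (B : Finset V) (γ : B → ℤˣ) (J : G.edgeSet → ℝ) (e : Sym2 V) :
    criticalDropletSize G B γ J e ≤ Fintype.card V := by
  by_cases h : ∃ A, IsCriticalDroplet G B γ J e A
  · obtain ⟨A, hA⟩ := h
    refine le_trans ?_ (dropletCard_le B A)
    exact Nat.sInf_le ⟨A, hA, rfl⟩
  · have : {n : ℕ | ∃ A : Finset V, IsCriticalDroplet G B γ J e A ∧ n = dropletCard B A} = ∅ := by
      ext n
      simp only [Set.mem_ofPred_eq, Set.mem_empty_iff_false, iff_false]
      exact fun ⟨A, hA, _⟩ => h ⟨A, hA⟩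
    rw [criticalDropletSize, this, Nat.sInf_empty]
    exact Nat.zero_le _

theorem integrable_criticalDropletSize (B : Finset V) (γ : B → ℤˣ) (e : Sym2 V) :
    Integrable (fun J => (criticalDropletSize G B γ J e : ℝ)) (disorderLaw G) := by
  refine Integrable.of_bound
    ((measurable_from_top (f := fun n : ℕ => (n : ℝ))).comp
      (measurable_criticalDropletSize B γ e)).aestronglyMeasurable (Fintype.card V : ℝ)
    (Filter.Eventually.of_forall fun J => ?_)
  rw [Real.norm_natCast]
  exact_mod_cast criticalDropletSize_le B γ J e

/-- Each constrained minimizer is unique up to a global sign; the droplet is complemented when the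
two signs differ, which a boundary spin excludes. -/
theorem IsCriticalDroplet.eq_or_eq_compl (hG : G.Preconnected) {B : Finset V} {γ : B → ℤˣ}
    {J : G.edgeSet → ℝ} (hJ : NoTies G J) {e : Sym2 V} {A A' : Finset V}
    (hA : IsCriticalDroplet G B γ J e A) (hA' : IsCriticalDroplet G B γ J e A') :
    A' = A ∨ B = ∅ ∧ A' = Aᶜ := by
  obtain ⟨σ₁, σ₂, h₁, h₂, h⟩ := hA
  obtain ⟨τ₁, τ₂, h₁', h₂', h'⟩ := hA'
  have k₁ := hJ.mul_eq_mul hG (h₁.hamiltonian_eq h₁')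
  have k₂ := hJ.mul_eq_mul hG (h₂.hamiltonian_eq h₂')
  have key : ∀ a b c d : ℤˣ, a * c = b * d → (a ≠ b ↔ c ≠ d) := by decide
  have key' : ∀ a b c d : ℤˣ, a * c ≠ b * d → (a ≠ b ↔ ¬ c ≠ d) := by decide
  have same (y : V) (hy : σ₁ y * τ₁ y = σ₂ y * τ₂ y) : A' = A := by
    ext x
    rw [h, h']
    exact (key _ _ _ _ (by rw [k₁ x y, k₂ x y, hy])).symm
  rcases B.eq_empty_or_nonempty with hB | ⟨b, hb⟩
  · rcases isEmpty_or_nonempty V with hV | ⟨⟨y⟩⟩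
    · exact Or.inl (Subsingleton.elim _ _)
    · by_cases hy : σ₁ y * τ₁ y = σ₂ y * τ₂ y
      · exact Or.inl (same y hy)
      · refine Or.inr ⟨hB, ?_⟩
        ext x
        rw [Finset.mem_compl, h, h', key' (σ₁ x) (σ₂ x) (τ₁ x) (τ₂ x) (by rwa [k₁ x y, k₂ x y]),
          not_not]
  · exact Or.inl (same b (by rw [h₁.1 ⟨b, hb⟩, h₁'.1 ⟨b, hb⟩, h₂.1 ⟨b, hb⟩, h₂'.1 ⟨b, hb⟩]))

theorem IsCriticalDroplet.criticalDropletSize_eq (hG : G.Preconnected) {B : Finset V}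
    {γ : B → ℤˣ} {J : G.edgeSet → ℝ} (hJ : NoTies G J) {e : Sym2 V} {A : Finset V}
    (hA : IsCriticalDroplet G B γ J e A) : criticalDropletSize G B γ J e = dropletCard B A := by
  obtain ⟨A', hA', h⟩ : criticalDropletSize G B γ J e ∈
      {n : ℕ | ∃ A : Finset V, IsCriticalDroplet G B γ J e A ∧ n = dropletCard B A} :=
    Nat.sInf_mem ⟨_, A, hA, rfl⟩
  rw [h]
  rcases hA.eq_or_eq_compl hG hJ hA' with rfl | ⟨rfl, rfl⟩
  · rfl
  · simp [dropletCard, min_comm]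

-- A boundary site `u` lies in no droplet, so a separated `v` lies in the droplet.
open Classical in
theorem card_dropletSeparates_le (hG : G.Preconnected) {B : Finset V} {γ : B → ℤˣ}
    {J : G.edgeSet → ℝ} (hJ : NoTies G J) (e : Sym2 V) {u : V} (hu : u ∈ B) :
    (Finset.univ.filter fun v => DropletSeparates G B γ J e u v).card ≤
      criticalDropletSize G B γ J e := by
  by_cases h : ∃ A, IsCriticalDroplet G B γ J e A
  · obtain ⟨A, hA⟩ := h
    have hB : B ≠ ∅ := Finset.ne_empty_of_mem hu
    rw [hA.criticalDropletSize_eq hG hJ, dropletCard, if_neg hB]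
    refine Finset.card_le_card fun v hv => ?_
    obtain ⟨A', hA', hv⟩ := (Finset.mem_filter_univ _).mp hv
    rcases hA.eq_or_eq_compl hG hJ hA' with rfl | ⟨hB', -⟩
    · obtain ⟨σ₁, σ₂, h₁, h₂, h⟩ := hA
      have : u ∉ A' := by rw [h, h₁.1 ⟨u, hu⟩, h₂.1 ⟨u, hu⟩]; simp
      tauto
    · exact absurd hB' hB
  · rw [Finset.filter_eq_empty_iff.mpr fun v _ ⟨A, hA, _⟩ => h ⟨A, hA⟩]
    exact Nat.zero_le _

-- A separated pair has one site in `A` and one in `Aᶜ`, hence one in the smaller of the two, called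
-- `M`; there are at most `2 |V| |M|` such pairs.
open Classical in
theorem card_dropletSeparates_free_le (hG : G.Preconnected) {γ : (∅ : Finset V) → ℤˣ}
    {J : G.edgeSet → ℝ} (hJ : NoTies G J) (e : Sym2 V) :
    (Finset.univ.filter fun p : V × V => DropletSeparates G ∅ γ J e p.1 p.2).card ≤
      2 * Fintype.card V * criticalDropletSize G ∅ γ J e := by
  by_cases h : ∃ A, IsCriticalDroplet G ∅ γ J e A
  · obtain ⟨A, hA⟩ := h
    rw [hA.criticalDropletSize_eq hG hJ, dropletCard, if_pos rfl]
    have key (M : Finset V) (hM : ∀ u v, ¬(u ∈ A ↔ v ∈ A) → u ∈ M ∨ v ∈ M) :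
        (Finset.univ.filter fun p : V × V => DropletSeparates G ∅ γ J e p.1 p.2).card ≤
          2 * Fintype.card V * M.card := by
      calc _ ≤ (M ×ˢ Finset.univ ∪ Finset.univ ×ˢ M).card := Finset.card_le_card fun p hp => by
            obtain ⟨A', hA', hp⟩ := (Finset.mem_filter_univ _).mp hp
            have : ¬(p.1 ∈ A ↔ p.2 ∈ A) := by
              rcases hA.eq_or_eq_compl hG hJ hA' with rfl | ⟨-, rfl⟩
              · exact hp
              · simpa only [Finset.mem_compl, not_iff_not] using hp
            simpa using hM _ _ this
        _ ≤ _ := (Finset.card_union_le _ _).trans (by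
            rw [Finset.card_product, Finset.card_product, Finset.card_univ]
            exact le_of_eq (by ring))
    rcases min_choice A.card Aᶜ.card with h | h <;> rw [h]
    · exact key A fun u v huv => by tauto
    · exact key Aᶜ fun u v huv => by simp only [Finset.mem_compl]; tauto
  · rw [Finset.filter_eq_empty_iff.mpr fun v _ ⟨A, hA, _⟩ => h ⟨A, hA⟩]
    exact Nat.zero_le _

open Classical in
theorem sum_measureReal_le_integral {Ω ι : Type*} [MeasurableSpace Ω] [Fintype ι] {μ : Measure Ω}
    [IsFiniteMeasure μ] {s : ι → Set Ω} (hs : ∀ i, MeasurableSet (s i)) {f : Ω → ℝ}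
    (hf : Integrable f μ)
    (h : ∀ᵐ ω ∂μ, ((Finset.univ.filter fun i => ω ∈ s i).card : ℝ) ≤ f ω) :
    ∑ i, μ.real (s i) ≤ ∫ ω, f ω ∂μ := by
  have hint (i : ι) : Integrable ((s i).indicator (1 : Ω → ℝ)) μ :=
    (integrable_const (1 : ℝ)).indicator (hs i)
  simp_rw [← integral_indicator_one (hs _)]
  rw [← integral_finsetSum _ fun i _ => hint i]
  refine integral_mono_ae (integrable_finsetSum _ fun i _ => hint i) hf ?_
  filter_upwards [h] with ω hω
  refine le_trans (le_of_eq ?_) hω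
  simp [Set.indicator_apply]

theorem natCast_le_sum_measureReal_dropletSeparates
    (hG : G.Preconnected) {B : Finset V} (γ : B → ℤˣ) {h : V → ℕ}
    (hh : ∀ x y, G.Adj x y → h x ≤ h y + 1) (hB : ∀ x ∈ B, h x = 0) {u : V} (hu : h u = 0)
    (v : V) :
    (h v : ℝ) ≤
      ∑ e : G.edgeSet, (disorderLaw G).real {J | DropletSeparates G B γ J (e : Sym2 V) u v} := by
  have := ENNReal.toReal_mono (ENNReal.sum_ne_top.mpr fun e _ => measure_ne_top _ _)
    (natCast_le_sum_measure_dropletSeparates hG γ hh hB hu v)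
  rwa [ENNReal.toReal_sum fun e _ => measure_ne_top _ _, ENNReal.toReal_natCast] at this

/-- The depth of the sites with respect to the boundary bounds the droplet sizes from below. -/
theorem sum_le_sum_integral_criticalDropletSize (hG : G.Preconnected) {B : Finset V}
    (γ : B → ℤˣ) (hne : B.Nonempty) {h : V → ℕ} (hh : ∀ x y, G.Adj x y → h x ≤ h y + 1)
    (hB : ∀ x ∈ B, h x = 0) :
    ∑ v, (h v : ℝ) ≤
      ∑ e : G.edgeSet, ∫ J, (criticalDropletSize G B γ J (e : Sym2 V) : ℝ) ∂(disorderLaw G) := by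
  obtain ⟨u, hu⟩ := hne
  refine (Finset.sum_le_sum fun v _ =>
    natCast_le_sum_measureReal_dropletSeparates hG γ hh hB (hB u hu) v).trans ?_
  rw [Finset.sum_comm]
  refine Finset.sum_le_sum fun e _ => sum_measureReal_le_integral
    (fun v => measurableSet_dropletSeparates B γ _ u v) (integrable_criticalDropletSize B γ _) ?_
  filter_upwards [ae_noTies G] with J hJ
  exact_mod_cast card_dropletSeparates_le hG hJ _ hu

/-- The distances between the sites bound the droplet sizes from below. -/
theorem sum_le_sum_integral_criticalDropletSize_free (hG : G.Preconnected)
    (γ : (∅ : Finset V) → ℤˣ) {h : V → V → ℕ} (hh : ∀ u x y, G.Adj x y → h u x ≤ h u y + 1)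
    (h0 : ∀ u, h u u = 0) :
    ∑ u, ∑ v, (h u v : ℝ) ≤ 2 * Fintype.card V *
      ∑ e : G.edgeSet, ∫ J, (criticalDropletSize G ∅ γ J (e : Sym2 V) : ℝ) ∂(disorderLaw G) := by
  rw [← Fintype.sum_prod_type' fun u v => (h u v : ℝ)]
  refine (Finset.sum_le_sum fun p _ => natCast_le_sum_measureReal_dropletSeparates hG γ (hh p.1)
    (fun x hx => absurd hx (Finset.notMem_empty x)) (h0 p.1) p.2).trans ?_
  rw [Finset.sum_comm, Finset.mul_sum]
  refine Finset.sum_le_sum fun e _ => ?_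
  rw [← integral_const_mul]
  refine sum_measureReal_le_integral (ι := V × V)
    (s := fun p => {J | DropletSeparates G ∅ γ J (e : Sym2 V) p.1 p.2})
    (fun p => measurableSet_dropletSeparates ∅ γ _ p.1 p.2)
    ((integrable_criticalDropletSize ∅ γ _).const_mul _) ?_
  filter_upwards [ae_noTies G] with J hJ
  exact_mod_cast card_dropletSeparates_free_le hG hJ _

theorem le_averageDropletSize {B : Finset V} {γ : B → ℤˣ} {K c : ℝ}
    (hE : (Fintype.card G.edgeSet : ℝ) ≤ K) (hc : 0 < c)
    (h : c * K ≤ ∑ e : G.edgeSet,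
      ∫ J, (criticalDropletSize G B γ J (e : Sym2 V) : ℝ) ∂(disorderLaw G)) (hK : 0 < K) :
    c ≤ averageDropletSize G B γ := by
  -- Without edges the sum would vanish, against `0 < c * K`.
  have hpos : 0 < Fintype.card G.edgeSet := by
    rw [Fintype.card_pos_iff]
    by_contra hempty
    rw [not_nonempty_iff] at hempty
    rw [Finset.univ_eq_empty, Finset.sum_empty] at h
    exact absurd h (not_le.mpr (mul_pos hc hK))
  have hpos' : (0 : ℝ) < Fintype.card G.edgeSet := by exact_mod_cast hpos
  rw [averageDropletSize, one_div, inv_mul_eq_div, le_div_iff₀ hpos']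
  exact (mul_le_mul_of_nonneg_left hE hc.le).trans h

end DropletSize

/-! ### Edge counts and the free-boundary bound -/

section Counting

theorem card_edgeSet_le {V ι : Type*} [Fintype V] [Fintype ι] (G : SimpleGraph V)
    [Fintype G.edgeSet] (N : V → ι → V) (hN : ∀ x y, G.Adj x y → ∃ i, y = N x i ∨ x = N y i) :
    Fintype.card G.edgeSet ≤ Fintype.card V * Fintype.card ι := by
  classical
  rw [← Fintype.card_prod, ← SimpleGraph.edgeFinset_card]
  refine (Finset.card_le_card (t := Finset.univ.image fun p : V × ι => s(p.1, N p.1 p.2))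
    fun e he => ?_).trans Finset.card_image_le
  induction e using Sym2.ind with
  | _ x y =>
    obtain ⟨i, h | h⟩ := hN x y (by simpa using he)
    · exact Finset.mem_image.mpr ⟨(x, i), Finset.mem_univ _, by rw [h]⟩
    · exact Finset.mem_image.mpr ⟨(y, i), Finset.mem_univ _, by rw [h, Sym2.eq_swap]⟩

variable {V : Type*} [Fintype V] [DecidableEq V]

/-- The average droplet size under the free boundary condition is at least of the order of the
displacement `m` of a permutation of the sites. -/
theorem le_averageDropletSizeFree [Nonempty V] {G : SimpleGraph V} [Fintype G.edgeSet]
    (hG : G.Preconnected) {h : V → V → ℕ} (hh : ∀ u x y, G.Adj x y → h u x ≤ h u y + 1)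
    (h0 : ∀ u, h u u = 0) (φ : V ≃ V) {m K : ℕ} (hφ : ∀ u v, m ≤ h u v + h u (φ v))
    (hE : Fintype.card G.edgeSet ≤ Fintype.card V * K) (hm : 0 < m) (hK : 0 < K) :
    (m : ℝ) / (4 * K) ≤ averageDropletSizeFree G := by
  have hV : (0 : ℝ) < Fintype.card V := by exact_mod_cast Fintype.card_pos
  have hm' : (0 : ℝ) < m := by exact_mod_cast hm
  have hK' : (0 : ℝ) < K := by exact_mod_cast hK
  refine le_averageDropletSize (K := Fintype.card V * K) (by exact_mod_cast hE) (by positivity) ?_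
    (by positivity)
  have h1 := sum_le_sum_integral_criticalDropletSize_free hG
    (fun v => absurd v.2 (Finset.notMem_empty _)) hh h0
  -- Averaging over `v` and `φ v` replaces an exact sum of distances. This costs one factor 2; the
  -- count of ordered pairs costs the other in `4 * K`.
  have h2 (u : V) : (Fintype.card V * m : ℝ) ≤ 2 * ∑ v, (h u v : ℝ) := by
    calc (Fintype.card V * m : ℝ) = ∑ v : V, (m : ℝ) := by simp
      _ ≤ ∑ v, ((h u v : ℝ) + h u (φ v)) := Finset.sum_le_sum fun v _ => by exact_mod_cast hφ u v
      _ = 2 * ∑ v, (h u v : ℝ) := by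
        rw [Finset.sum_add_distrib, Equiv.sum_comp φ fun v => (h u v : ℝ), two_mul]
  have h3 : (Fintype.card V * (Fintype.card V * m) : ℝ) ≤ 2 * ∑ u, ∑ v, (h u v : ℝ) := by
    rw [Finset.mul_sum]
    calc (Fintype.card V * (Fintype.card V * m) : ℝ) = ∑ u : V, (Fintype.card V * m : ℝ) := by simp
      _ ≤ _ := Finset.sum_le_sum fun u _ => h2 u
  set S := ∑ e : G.edgeSet, ∫ J, (criticalDropletSize G ∅
    (fun v => absurd v.2 (Finset.notMem_empty _)) J (e : Sym2 V) : ℝ) ∂(disorderLaw G)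
  have h4 : (Fintype.card V : ℝ) * (Fintype.card V * m) ≤ Fintype.card V * (4 * S) := by
    linarith
  have h5 := le_of_mul_le_mul_left h4 hV
  calc (m : ℝ) / (4 * K) * (Fintype.card V * K) = Fintype.card V * m / 4 := by field_simp
    _ ≤ S := by linarith

end Counting

/-! ### The periodic case -/

section Torus

/-- The translations that keep every site in its component form a subgroup containing the unit
vectors. -/
theorem torusGraph_preconnected (d L : ℕ) : (torusGraph d L).Preconnected := by
  have step (x : Fin d → ZMod L) (k : Fin d) :
      (torusGraph d L).Reachable x (x + Pi.single k 1) := by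
    by_cases h : x = x + Pi.single k 1
    · exact h ▸ SimpleGraph.Reachable.refl x
    · exact SimpleGraph.Adj.reachable ⟨h, k, Or.inl rfl⟩
  let P : AddSubgroup (Fin d → ZMod L) :=
    { carrier := {a | ∀ x, (torusGraph d L).Reachable x (x + a)}
      zero_mem' := fun x => by rw [add_zero]
      add_mem' := fun {a b} ha hb x => by
        rw [← add_assoc]
        exact (ha x).trans (hb _)
      neg_mem' := fun {a} ha x => by
        have := (ha (x + -a)).symm
        rwa [neg_add_cancel_right] at this }
  have hP (a : Fin d → ZMod L) : a ∈ P := by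
    rw [← Finset.univ_sum_single a]
    refine sum_mem fun k _ => ?_
    have : (Pi.single k (a k) : Fin d → ZMod L) = (a k).cast (R := ℤ) • Pi.single k 1 := by
      rw [← Pi.single_smul, zsmul_one, ZMod.intCast_zmod_cast]
    rw [this]
    exact P.zsmul_mem (fun x => step x k) _
  intro x y
  have := hP (y - x) x
  rwa [add_sub_cancel] at this

/-- Here `h` is the cyclic distance in one coordinate and `φ` the translation by `L / 2`, the
largest displacement on the cycle. -/
theorem le_averageDropletSizeFree_torusGraph {d L : ℕ} [NeZero L] (hd : 1 ≤ d) (hL : 2 ≤ L) :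
    ((L / 2 : ℕ) : ℝ) / (4 * d) ≤ averageDropletSizeFree (torusGraph d L) := by
  let k₀ : Fin d := ⟨0, hd⟩
  let nrm : ZMod L → ℕ := fun a => a.valMinAbs.natAbs
  have nrm_add (a b : ZMod L) : nrm (a + b) ≤ nrm a + nrm b :=
    (ZMod.natAbs_valMinAbs_add_le a b).trans (Int.natAbs_add_le _ _)
  have nrm_neg (a : ZMod L) : nrm (-a) = nrm a := ZMod.natAbs_valMinAbs_neg a
  have nrm_zero : nrm 0 = 0 := by simp [nrm]
  have nrm_natCast {a : ℕ} (ha : a ≤ L / 2) : nrm a = a := by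
    simp only [nrm, ZMod.valMinAbs_natCast_of_le_half ha, Int.natAbs_natCast]
  have nrm_one : nrm 1 = 1 := by
    have := nrm_natCast (a := 1) (by omega)
    rwa [Nat.cast_one] at this
  refine le_averageDropletSizeFree (torusGraph_preconnected d L)
    (h := fun u x => nrm (x k₀ - u k₀)) ?_ (fun u => by simp only [sub_self, nrm_zero])
    (Equiv.addRight (Pi.single k₀ ((L / 2 : ℕ) : ZMod L))) ?_ ?_ (by omega) hd
  · intro u x y hxy
    have hdiff : nrm (x k₀ - y k₀) ≤ 1 := by
      obtain ⟨-, k, rfl | rfl⟩ := hxy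
      · by_cases hk : k₀ = k
        · subst hk; simp [nrm_neg, nrm_one]
        · simp [hk, nrm_zero]
      · by_cases hk : k₀ = k
        · subst hk; simp [nrm_one]
        · simp [hk, nrm_zero]
    have := nrm_add (y k₀ - u k₀) (x k₀ - y k₀)
    rw [show y k₀ - u k₀ + (x k₀ - y k₀) = x k₀ - u k₀ by ring] at this
    omega
  · intro u v
    have := nrm_add (v k₀ + ((L / 2 : ℕ) : ZMod L) - u k₀) (-(v k₀ - u k₀))
    rw [nrm_neg, show v k₀ + ((L / 2 : ℕ) : ZMod L) - u k₀ + -(v k₀ - u k₀) =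
      ((L / 2 : ℕ) : ZMod L) by ring, nrm_natCast le_rfl] at this
    simp only [Equiv.coe_addRight, Pi.add_apply, Pi.single_eq_same]
    omega
  · have := card_edgeSet_le (torusGraph d L) (fun x (k : Fin d) => x + Pi.single k 1)
      fun x y h => h.2
    rwa [Fintype.card_fin] at this

end Torus

/-! ### The cube with free and with fixed boundary -/

section Cube

variable {d L : ℕ}

theorem abs_sub_le_one_of_cubeGraph_adj {x y : Fin d → Fin (L + 1)} (h : (cubeGraph d L).Adj x y)
    (k : Fin d) : |((x k : ℕ) : ℤ) - ((y k : ℕ) : ℤ)| ≤ 1 :=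
  (Finset.single_le_sum (f := fun k => |((x k : ℕ) : ℤ) - ((y k : ℕ) : ℤ)|)
    (fun _ _ => abs_nonneg _) (Finset.mem_univ k)).trans (le_of_eq h)

/-- Lowering a nonzero coordinate by 1 is a step along an edge and decreases the coordinate sum,
until the origin is reached. -/
theorem cubeGraph_preconnected (d L : ℕ) : (cubeGraph d L).Preconnected := by
  have key : ∀ (n : ℕ) (x : Fin d → Fin (L + 1)), ∑ k, (x k : ℕ) = n →
      (cubeGraph d L).Reachable x 0 := by
    intro n
    induction n with
    | zero =>
      intro x hx
      have : x = 0 := by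
        funext k
        exact Fin.ext (Finset.sum_eq_zero_iff.mp hx k (Finset.mem_univ k))
      rw [this]
    | succ n ih =>
      intro x hx
      obtain ⟨k, -, hk⟩ := Finset.exists_ne_zero_of_sum_ne_zero (hx.trans_ne n.succ_ne_zero)
      obtain ⟨a, ha⟩ : ∃ a : Fin (L + 1), (a : ℕ) = x k - 1 := ⟨⟨x k - 1, by omega⟩, rfl⟩
      have hsum := Finset.add_sum_erase Finset.univ (fun j => (x j : ℕ)) (Finset.mem_univ k)
      have hsum' := Finset.add_sum_erase Finset.univ (fun j => (Function.update x k a j : ℕ))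
        (Finset.mem_univ k)
      have hcongr : ∑ j ∈ Finset.univ.erase k, (Function.update x k a j : ℕ) =
          ∑ j ∈ Finset.univ.erase k, (x j : ℕ) :=
        Finset.sum_congr rfl fun j hj => by
          rw [Function.update_of_ne (Finset.ne_of_mem_erase hj)]
      rw [hcongr] at hsum'
      simp only [Function.update_self] at hsum hsum'
      refine SimpleGraph.Reachable.trans (SimpleGraph.Adj.reachable ?_)
        (ih (Function.update x k a) (by omega))
      change ∑ j, _ = _
      rw [Finset.sum_eq_single k]
      · rw [Function.update_self, ha, Nat.cast_sub (by omega)]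
        simp
      · intro j _ hj
        simp [Function.update_of_ne hj]
      · simp
  exact fun x y => (key _ x rfl).trans (key _ y rfl).symm

theorem exists_eq_add_single_of_cubeGraph_adj {x y : Fin d → Fin (L + 1)}
    (h : (cubeGraph d L).Adj x y) : ∃ k, y = x + Pi.single k 1 ∨ x = y + Pi.single k 1 := by
  have hsum : ∑ k, |((x k : ℕ) : ℤ) - ((y k : ℕ) : ℤ)| = 1 := h
  obtain ⟨k, -, hk⟩ := Finset.exists_ne_zero_of_sum_ne_zero (hsum.trans_ne one_ne_zero)
  have hk1 : |((x k : ℕ) : ℤ) - ((y k : ℕ) : ℤ)| = 1 :=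
    le_antisymm (abs_sub_le_one_of_cubeGraph_adj h k)
      (Int.one_le_abs (abs_ne_zero.mp hk))
  rw [← Finset.add_sum_erase _ _ (Finset.mem_univ k), hk1] at hsum
  have hrest := (Finset.sum_eq_zero_iff_of_nonneg (fun j _ => abs_nonneg _)).mp
    (add_eq_left.mp hsum)
  have hother (j : Fin d) (hj : j ≠ k) : x j = y j := by
    have := abs_eq_zero.mp (hrest j (Finset.mem_erase.mpr ⟨hj, Finset.mem_univ j⟩))
    exact Fin.ext (by omega)
  have step (a b : Fin (L + 1)) (hab : (b : ℕ) = a + 1) : b = a + 1 :=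
    Fin.ext (by rw [Fin.val_add_one_of_lt' (by omega), hab])
  refine ⟨k, ?_⟩
  rcases (abs_eq zero_le_one).mp hk1 with h' | h'
  · refine Or.inr (funext fun j => ?_)
    by_cases hj : j = k
    · subst hj
      simpa using step (y j) (x j) (by omega)
    · simp [hj, hother j hj]
  · refine Or.inl (funext fun j => ?_)
    by_cases hj : j = k
    · subst hj
      simpa using step (x j) (y j) (by omega)
    · simp [hj, hother j hj]

theorem card_edgeSet_cubeGraph_le [Fintype (cubeGraph d L).edgeSet] :
    Fintype.card (cubeGraph d L).edgeSet ≤ Fintype.card (Fin d → Fin (L + 1)) * d := by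
  have := card_edgeSet_le (cubeGraph d L) (fun x (k : Fin d) => x + Pi.single k 1)
    fun x y h => exists_eq_add_single_of_cubeGraph_adj h
  rwa [Fintype.card_fin] at this

/-- The cyclic shift of one coordinate by `(L + 1) / 2` modulo `L + 1` moves it by at least `(L + 1)
/ 2` even when it wraps around. -/
theorem le_averageDropletSizeFree_cubeGraph (hd : 1 ≤ d) (hL : 1 ≤ L) :
    (((L + 1) / 2 : ℕ) : ℝ) / (4 * d) ≤ averageDropletSizeFree (cubeGraph d L) := by
  let k₀ : Fin d := ⟨0, hd⟩
  let a : Fin (L + 1) := ⟨(L + 1) / 2, by omega⟩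
  refine le_averageDropletSizeFree (cubeGraph_preconnected d L)
    (h := fun u x => (((x k₀ : ℕ) : ℤ) - ((u k₀ : ℕ) : ℤ)).natAbs) ?_ (fun u => by simp)
    (Equiv.addRight (Pi.single k₀ a)) ?_ card_edgeSet_cubeGraph_le (by omega) hd
  · intro u x y hxy
    have := abs_sub_le_one_of_cubeGraph_adj hxy k₀
    rw [abs_le] at this
    omega
  · intro u v
    simp only [Equiv.coe_addRight, Pi.add_apply, Pi.single_eq_same, Fin.val_add_eq_ite, a]
    split_ifs <;> omega

/-- The distance to the boundary of the cube. -/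
def cubeDepth [NeZero d] (x : Fin d → Fin (L + 1)) : ℕ :=
  Finset.univ.inf' Finset.univ_nonempty fun k => min (x k : ℕ) (L - x k)

theorem cubeDepth_le_add_one [NeZero d] {x y : Fin d → Fin (L + 1)}
    (h : (cubeGraph d L).Adj x y) : cubeDepth x ≤ cubeDepth y + 1 := by
  obtain ⟨k, -, hk⟩ := Finset.exists_mem_eq_inf' (Finset.univ_nonempty (α := Fin d))
    fun k => min (y k : ℕ) (L - y k)
  rw [cubeDepth, cubeDepth, hk]
  refine (Finset.inf'_le _ (Finset.mem_univ k)).trans ?_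
  have := abs_sub_le_one_of_cubeGraph_adj h k
  rw [abs_le] at this
  omega

theorem cubeDepth_eq_zero [NeZero d] {x : Fin d → Fin (L + 1)} (h : x ∈ cubeBoundary d L) :
    cubeDepth x = 0 := by
  obtain ⟨k, hk⟩ := (Finset.mem_filter_univ _).mp h
  refine Nat.le_zero.mp ((Finset.inf'_le _ (Finset.mem_univ k)).trans ?_)
  omega

theorem le_sum_cubeDepth [NeZero d] (hL : 2 ≤ L) :
    (L : ℝ) / 4 * (((L + 1 : ℝ) / 3) ^ d) ≤ ∑ x : Fin d → Fin (L + 1), (cubeDepth x : ℝ) := by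
  -- `q` is `L / 4` rounded up. Sites with all coordinates in `[q, L - q]` have depth at least `q`,
  -- and this interval holds at least a third of the `L + 1` values.
  let q := (L + 3) / 4
  let I : Finset (Fin (L + 1)) := Finset.Icc ⟨q, by omega⟩ ⟨L - q, by omega⟩
  have hI : ((L + 1 : ℝ) / 3) ≤ I.card := by
    rw [div_le_iff₀ three_pos, Fin.card_Icc]
    exact_mod_cast (show L + 1 ≤ (L - q + 1 - q) * 3 by omega)
  have hq : (L : ℝ) / 4 ≤ q := by
    rw [div_le_iff₀ four_pos]
    exact_mod_cast (show L ≤ q * 4 by omega)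
  calc (L : ℝ) / 4 * (((L + 1 : ℝ) / 3) ^ d) ≤ q * (I.card : ℝ) ^ d := by gcongr
    _ = ∑ x ∈ Fintype.piFinset fun _ : Fin d => I, (q : ℝ) := by
      rw [Finset.sum_const, Fintype.card_piFinset_const, nsmul_eq_mul, Nat.cast_pow, mul_comm]
    _ ≤ ∑ x ∈ Fintype.piFinset fun _ : Fin d => I, (cubeDepth x : ℝ) := by
      refine Finset.sum_le_sum fun x hx => ?_
      have : q ≤ cubeDepth x := by
        refine Finset.le_inf' _ _ fun k _ => ?_
        have hk := Finset.mem_Icc.mp (Fintype.mem_piFinset.mp hx k)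
        have h1 : q ≤ (x k : ℕ) := hk.1
        have h2 : (x k : ℕ) ≤ L - q := hk.2
        omega
      exact_mod_cast this
    _ ≤ _ := Finset.sum_le_sum_of_subset_of_nonneg (Finset.subset_univ _)
      fun x _ _ => Nat.cast_nonneg _

theorem le_averageDropletSize_cubeGraph (hd : 1 ≤ d) (hL : 2 ≤ L) (γ : cubeBoundary d L → ℤˣ) :
    (L : ℝ) / (4 * 3 ^ d * d) ≤ averageDropletSize (cubeGraph d L) (cubeBoundary d L) γ := by
  have : NeZero d := ⟨by omega⟩
  have hne : (cubeBoundary d L).Nonempty :=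
    ⟨0, (Finset.mem_filter_univ _).mpr ⟨0, Or.inl rfl⟩⟩
  have hd' : (0 : ℝ) < d := by exact_mod_cast hd
  have hL' : (0 : ℝ) < L := by exact_mod_cast (by omega : 0 < L)
  refine le_averageDropletSize (K := (L + 1 : ℝ) ^ d * d) ?_ (by positivity) ?_ (by positivity)
  · have := card_edgeSet_cubeGraph_le (d := d) (L := L)
    rw [Fintype.card_fun, Fintype.card_fin, Fintype.card_fin] at this
    exact_mod_cast this
  · refine le_trans (le_of_eq ?_) ((le_sum_cubeDepth hL).trans
      (sum_le_sum_integral_criticalDropletSize (cubeGraph_preconnected d L) γ hne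
        (fun x y => cubeDepth_le_add_one) fun x => cubeDepth_eq_zero))
    rw [div_pow]
    field_simp

end Cube

end EdwardsAnderson

/-! ### A common constant for the three cases -/

theorem mainTheorem10 (d : ℕ) (hd : 1 ≤ d) :
    ∃ C : ℝ, 0 < C ∧
      (∀ L : ℕ, 2 ≤ L → ∀ γ : EdwardsAnderson.cubeBoundary d L → ℤˣ,
        EdwardsAnderson.averageDropletSize (EdwardsAnderson.cubeGraph d L)
          (EdwardsAnderson.cubeBoundary d L) γ ≥ C * (L : ℝ)) ∧
      (∀ L : ℕ, 1 ≤ L →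
        EdwardsAnderson.averageDropletSizeFree (EdwardsAnderson.cubeGraph d L) ≥ C * (L : ℝ)) ∧
      (∀ (L : ℕ) [NeZero L], 2 ≤ L →
        EdwardsAnderson.averageDropletSizeFree (EdwardsAnderson.torusGraph d L) ≥ C * (L : ℝ)) := by
  have hd' : (0 : ℝ) < d := by exact_mod_cast hd
  have hpow : (3 : ℝ) ≤ 3 ^ d := by
    simpa using pow_le_pow_right₀ (by norm_num : (1 : ℝ) ≤ 3) hd
  -- The fixed-boundary constant is the smallest: `L / 2` and `(L + 1) / 2` are at least `L / 3` in
  -- the ranges used, and `3 ≤ 3 ^ d`.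
  have key {L m : ℕ} (h : L ≤ 3 * m) : 1 / (4 * 3 ^ d * d) * (L : ℝ) ≤ (m : ℝ) / (4 * d) := by
    have h' : (L : ℝ) ≤ 3 * m := by exact_mod_cast h
    have h3 : (L : ℝ) ≤ 3 ^ d * m := h'.trans (mul_le_mul_of_nonneg_right hpow m.cast_nonneg)
    rw [one_div_mul_eq_div, div_le_div_iff₀ (by positivity) (by positivity)]
    calc (L : ℝ) * (4 * d) ≤ 3 ^ d * m * (4 * d) := by gcongr
      _ = m * (4 * 3 ^ d * d) := by ring
  refine ⟨1 / (4 * 3 ^ d * d), by positivity, fun L hL γ => ?_, fun L hL => ?_, fun L _ hL => ?_⟩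
  · rw [one_div_mul_eq_div]
    exact EdwardsAnderson.le_averageDropletSize_cubeGraph hd hL γ
  · exact (key (by omega)).trans (EdwardsAnderson.le_averageDropletSizeFree_cubeGraph hd hL)
  · exact (key (by omega)).trans (EdwardsAnderson.le_averageDropletSizeFree_torusGraph hd hL)
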